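/- Let $\mathcal P$ be the Banach space of $C^2$ functions $V:\mathbb R\to\mathbb R$ with $\|V\|_2=\sup_{x}\max\{|V(x)|,|V'(x)|,|V''(x)|\}<\infty$. For $T>0$ and $k\in\{0,2\}$ let $C^+_{T,k}$ be the Banach space of even, $T$-periodic $C^k$ functions $\mathbb R\to\mathbb R$ with the uniform $C^k$ norm, and let $F:C^+_{T,2}\oplus\mathcal P\to C^+_{T,0}$, $F(q,V)=\ddot q+V'(q)$. A potential $V\in\mathcal P$ is *anharmonic at* $q\in C^+_{T,2}$ if $q$ is nonconstant, $F(q,V)=0$, and the partial derivative $DF_{(q,V)}:C^+_{T,2}\to C^+_{T,0}$ of $F$ with respect to $q$ has kernel $\{0\}$. A *perturbation neighbourhood* of $(q,V)$ is a pair $(\mathcal U,f)$ with $\mathcal U\subset\mathcal P$ open, $V\in\mathcal U$, and $f:\mathcal U\to C^+_{T,2}$ a $C^1$ map such that $f(V)=q$ and every $W\in\mathcal U$ is anharmonic at $f(W)$. For $T\in2\pi\mathbb Z^+$, $V$ is *degenerate at* $q\in C^+_{T,2}$ if $V$ is anharmonic at $q$ and $\int_0^T\cos t\,q(t)\,dt=0$.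 **Theorem.** Let $T\in 2\pi\mathbb Z^+$, let $V_0\in\mathcal P$ be degenerate at $q_0\in C^+_{T,2}$, where the fundamental period of $q_0$ is an integer multiple of $2\pi$ (for instance $T$ itself), and let $(\mathcal U,f)$ be a perturbation neighbourhood of $(q_0,V_0)$ with $\mathcal U$ connected. Then the set $$\mathcal S=\{W\in\mathcal U : W \text{ is degenerate at } f(W)\}$$ on which degeneracy persists is a $C^1$ submanifold of $\mathcal U$ of codimension $1$. Consequently the sign change of $\chi_1(0)$ across the resonance $T$ is generic, in the following sense. The set $\mathcal U\setminus\mathcal S$ is open, and it is dense in $\mathcal U$. Moreover, let $W\in\mathcal U\setminus\mathcal S$, and let $(x_\tau)_{|\tau-T|<\delta}$, $\delta>0$, be any family of even $\tau$-periodic $C^2$ solutions of $\ddot x+W'(x)=0$ such that $x_T=f(W)$ and $(\tau,t)\mapsto x_\tau(t)$ is continuous. Then for all $\tau\neq T$ close enough to $T$ there is exactly one even $\tau$-periodic $C^2$ solution $\chi_{1,\tau}$ of $\ddot\chi+\chi=x_\tau$, and $\chi_{1,\tau}(0)$ is nonzero and has opposite signs for $\tau<T$ and for $\tau>T$ (close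 enough to $T$). -/

import Mathlib

open scoped BoundedContinuousFunction

noncomputable section

/-! ### The function spaces -/

/-- The space of twice continuously differentiable functions `V : ℝ → ℝ` for which
`V`, `V'` and `V''` are bounded. Such a function is recorded together with its first two
derivatives, as a triple `(V, V', V'')` of bounded continuous functions; the norm inherited from
the product is `max (sup |V|) (sup |V'|) (sup |V''|)`, i.e. the uniform `C²` norm. -/
def c2Bounded : Submodule ℝ ((ℝ →ᵇ ℝ) × (ℝ →ᵇ ℝ) × (ℝ →ᵇ ℝ)) where
  carrier := {j | (∀ x, HasDerivAt j.1 (j.2.1 x) x) ∧ ∀ x, HasDerivAt j.2.1 (j.2.2 x) x}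
  add_mem' := fun ha hb =>
    ⟨fun x => (ha.1 x).add (hb.1 x), fun x => (ha.2 x).add (hb.2 x)⟩
  zero_mem' := ⟨fun x => hasDerivAt_const x (0 : ℝ), fun x => hasDerivAt_const x (0 : ℝ)⟩
  smul_mem' := fun c _ ha =>
    ⟨fun x => (ha.1 x).const_smul c, fun x => (ha.2 x).const_smul c⟩

/-- The Banach space `𝒫` of `C²` potentials with finite `C²` norm. -/
def Potential : Type := ↥c2Bounded

instance : NormedAddCommGroup Potential := inferInstanceAs (NormedAddCommGroup ↥c2Bounded)

instance : NormedSpace ℝ Potential := inferInstanceAs (NormedSpace ℝ ↥c2Bounded)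

namespace Potential

/-- The underlying function `V`. -/
def fn (V : Potential) : ℝ →ᵇ ℝ := V.1.1

/-- The derivative `V'`. -/
def d1 (V : Potential) : ℝ →ᵇ ℝ := V.1.2.1

/-- The second derivative `V''`. -/
def d2 (V : Potential) : ℝ →ᵇ ℝ := V.1.2.2

theorem hasDerivAt_fn (V : Potential) (x : ℝ) : HasDerivAt V.fn (V.d1 x) x := V.2.1 x

theorem hasDerivAt_d1 (V : Potential) (x : ℝ) : HasDerivAt V.d1 (V.d2 x) x := V.2.2 x

theorem deriv_fn (V : Potential) : deriv V.fn = V.d1 :=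
  funext fun x => (V.hasDerivAt_fn x).deriv

theorem deriv_d1 (V : Potential) : deriv V.d1 = V.d2 :=
  funext fun x => (V.hasDerivAt_d1 x).deriv

/-- The functions in the space are exactly the `C²` functions that are bounded together with
their first two derivatives. -/
theorem exists_fn_eq_iff (g : ℝ → ℝ) :
    (∃ V : Potential, (V.fn : ℝ → ℝ) = g) ↔
      ContDiff ℝ 2 g ∧
        ∃ C, ∀ x, |g x| ≤ C ∧ |deriv g x| ≤ C ∧ |deriv (deriv g) x| ≤ C := by
  constructor
  · rintro ⟨V, rfl⟩
    refine ⟨?_, max ‖V.fn‖ (max ‖V.d1‖ ‖V.d2‖), fun x => ?_⟩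
    · rw [show (2 : WithTop ℕ∞) = 1 + 1 by norm_num, contDiff_succ_iff_deriv]
      refine ⟨fun x => (V.hasDerivAt_fn x).differentiableAt, by simp, ?_⟩
      rw [V.deriv_fn, contDiff_one_iff_deriv, V.deriv_d1]
      exact ⟨fun x => (V.hasDerivAt_d1 x).differentiableAt, V.d2.continuous⟩
    · rw [V.deriv_fn, V.deriv_d1]
      exact ⟨le_max_of_le_left (V.fn.norm_coe_le_norm x),
        le_max_of_le_right (le_max_of_le_left (V.d1.norm_coe_le_norm x)),
        le_max_of_le_right (le_max_of_le_right (V.d2.norm_coe_le_norm x))⟩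
  · rintro ⟨hg, C, hC⟩
    rw [show (2 : WithTop ℕ∞) = 1 + 1 by norm_num, contDiff_succ_iff_deriv] at hg
    obtain ⟨h0, -, h1⟩ := hg
    rw [contDiff_one_iff_deriv] at h1
    refine ⟨⟨(BoundedContinuousFunction.ofNormedAddCommGroup g h0.continuous C
        fun x => (hC x).1,
      BoundedContinuousFunction.ofNormedAddCommGroup (deriv g) h1.1.continuous C
        fun x => (hC x).2.1,
      BoundedContinuousFunction.ofNormedAddCommGroup (deriv (deriv g)) h1.2 C
        fun x => (hC x).2.2),
      fun x => (h0 x).hasDerivAt, fun x => (h1.1 x).hasDerivAt⟩, rfl⟩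

end Potential

/-- The space of continuous `T`-periodic even functions `ℝ → ℝ`, with the uniform norm. -/
def evenPeriodicC0 (T : ℝ) : Submodule ℝ (ℝ →ᵇ ℝ) where
  carrier := {g | Function.Periodic g T ∧ Function.Even g}
  add_mem' := fun ha hb =>
    ⟨fun t => congrArg₂ (· + ·) (ha.1 t) (hb.1 t), fun t => congrArg₂ (· + ·) (ha.2 t) (hb.2 t)⟩
  zero_mem' := ⟨fun _ => rfl, fun _ => rfl⟩
  smul_mem' := fun c _ ha =>
    ⟨fun t => congrArg (c * ·) (ha.1 t), fun t => congrArg (c * ·) (ha.2 t)⟩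

/-- The space of twice continuously differentiable `T`-periodic even functions `ℝ → ℝ`, with the
uniform `C²` norm. (For `T > 0` the boundedness of `q`, `q'`, `q''` is automatic.) -/
def evenPeriodicC2 (T : ℝ) : Submodule ℝ Potential where
  carrier := {q | Function.Periodic q.fn T ∧ Function.Even q.fn}
  add_mem' := fun ha hb =>
    ⟨fun t => congrArg₂ (· + ·) (ha.1 t) (hb.1 t), fun t => congrArg₂ (· + ·) (ha.2 t) (hb.2 t)⟩
  zero_mem' := ⟨fun _ => rfl, fun _ => rfl⟩
  smul_mem' := fun c _ ha =>
    ⟨fun t => congrArg (c * ·) (ha.1 t), fun t => congrArg (c * ·) (ha.2 t)⟩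

/-- The Banach space `C⁺_{T,0}`. -/
def CT0 (T : ℝ) : Type := ↥(evenPeriodicC0 T)

instance (T : ℝ) : NormedAddCommGroup (CT0 T) :=
  inferInstanceAs (NormedAddCommGroup ↥(evenPeriodicC0 T))

instance (T : ℝ) : NormedSpace ℝ (CT0 T) := inferInstanceAs (NormedSpace ℝ ↥(evenPeriodicC0 T))

/-- The Banach space `C⁺_{T,2}`. -/
def CT2 (T : ℝ) : Type := ↥(evenPeriodicC2 T)

instance (T : ℝ) : NormedAddCommGroup (CT2 T) :=
  inferInstanceAs (NormedAddCommGroup ↥(evenPeriodicC2 T))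

instance (T : ℝ) : NormedSpace ℝ (CT2 T) := inferInstanceAs (NormedSpace ℝ ↥(evenPeriodicC2 T))

/-- The underlying function of an element of `C⁺_{T,0}`. -/
def CT0.fn {T : ℝ} (g : CT0 T) : ℝ →ᵇ ℝ := g.1

namespace CT2

variable {T : ℝ}

/-- The underlying function `q`. -/
def fn (q : CT2 T) : ℝ →ᵇ ℝ := q.1.fn

/-- The second derivative `q̈`. -/
def d2 (q : CT2 T) : ℝ →ᵇ ℝ := q.1.d2

theorem periodic_fn (q : CT2 T) : Function.Periodic q.fn T := q.2.1

theorem even_fn (q : CT2 T) : Function.Even q.fn := q.2.2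

theorem periodic_d2 (q : CT2 T) : Function.Periodic q.d2 T := by
  have h1 : ∀ t, q.1.d1 (t + T) = q.1.d1 t := fun t => by
    have h := (q.1.hasDerivAt_fn (t + T)).comp_add_const t T
    rw [show (fun x => q.1.fn (x + T)) = q.1.fn from funext q.periodic_fn] at h
    exact h.unique (q.1.hasDerivAt_fn t)
  intro t
  have h := (q.1.hasDerivAt_d1 (t + T)).comp_add_const t T
  rw [show (fun x => q.1.d1 (x + T)) = q.1.d1 from funext h1] at h
  exact h.unique (q.1.hasDerivAt_d1 t)

theorem even_d2 (q : CT2 T) : Function.Even q.d2 := by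
  have h1 : ∀ t, q.1.d1 (-t) = -q.1.d1 t := fun t => by
    have h := (q.1.hasDerivAt_fn (-t)).scomp t (hasDerivAt_neg t)
    rw [show (q.1.fn : ℝ → ℝ) ∘ Neg.neg = q.1.fn from funext q.even_fn] at h
    have := h.unique (q.1.hasDerivAt_fn t)
    simp only [smul_eq_mul] at this
    linarith
  intro t
  have h := (q.1.hasDerivAt_d1 (-t)).scomp t (hasDerivAt_neg t)
  rw [show (q.1.d1 : ℝ → ℝ) ∘ Neg.neg = fun s => -q.1.d1 s from funext h1] at h
  have := h.unique (q.1.hasDerivAt_d1 t).neg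
  simp only [smul_eq_mul] at this
  change q.1.d2 (-t) = q.1.d2 t
  linarith

/-- The norm of `C⁺_{T,2}` is the uniform `C²` norm. -/
theorem norm_eq (q : CT2 T) : ‖q‖ = max ‖q.fn‖ (max ‖q.1.d1‖ ‖q.d2‖) := rfl

theorem norm_fn_le (q : CT2 T) : ‖q.fn‖ ≤ ‖q‖ := le_max_left _ _

theorem norm_d2_le (q : CT2 T) : ‖q.d2‖ ≤ ‖q‖ :=
  (le_max_right ‖q.1.d1‖ ‖q.d2‖).trans (le_max_right _ _)

end CT2

/-! ### Newton's equation, anharmonicity, degeneracy -/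

/-- The mapping `F(q, V) = q̈ + V'(q)` from `C⁺_{T,2} ⊕ 𝒫` to `C⁺_{T,0}`. -/
def newtonMap (T : ℝ) (q : CT2 T) (V : Potential) : CT0 T :=
  ⟨q.d2 + V.d1.compContinuous q.fn.toContinuousMap,
    fun t => congrArg₂ (· + ·) (q.periodic_d2 t) (congrArg V.d1 (q.periodic_fn t)),
    fun t => congrArg₂ (· + ·) (q.even_d2 t) (congrArg V.d1 (q.even_fn t))⟩

@[simp] theorem newtonMap_apply (T : ℝ) (q : CT2 T) (V : Potential) (t : ℝ) :
    (newtonMap T q V).fn t = q.d2 t + V.d1 (q.fn t) := rfl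

/-- The partial derivative `DF_{(q,V)} : C⁺_{T,2} → C⁺_{T,0}` of `F` with respect to `q`. -/
def newtonPartial (T : ℝ) (q : CT2 T) (V : Potential) : CT2 T →L[ℝ] CT0 T :=
  fderiv ℝ (fun p : CT2 T => newtonMap T p V) q

/-- The linearised operator written out: `DF_{(q,V)} h = ḧ + V''(q) h`. -/
def linearised (T : ℝ) (q : CT2 T) (V : Potential) : CT2 T →L[ℝ] CT0 T :=
  LinearMap.mkContinuous
    { toFun := fun h => ⟨h.d2 + V.d2.compContinuous q.fn.toContinuousMap * h.fn,
        fun t => congrArg₂ (· + ·) (h.periodic_d2 t)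
          (congrArg₂ (· * ·) (congrArg V.d2 (q.periodic_fn t)) (h.periodic_fn t)),
        fun t => congrArg₂ (· + ·) (h.even_d2 t)
          (congrArg₂ (· * ·) (congrArg V.d2 (q.even_fn t)) (h.even_fn t))⟩
      map_add' := fun h k => Subtype.ext <| BoundedContinuousFunction.ext fun t => by
        change (h.d2 t + k.d2 t) + V.d2 (q.fn t) * (h.fn t + k.fn t) =
          (h.d2 t + V.d2 (q.fn t) * h.fn t) + (k.d2 t + V.d2 (q.fn t) * k.fn t)
        ring
      map_smul' := fun c h => Subtype.ext <| BoundedContinuousFunction.ext fun t => by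
        change c * h.d2 t + V.d2 (q.fn t) * (c * h.fn t) =
          c * (h.d2 t + V.d2 (q.fn t) * h.fn t)
        ring }
    (1 + ‖V.d2‖) fun h => by
      refine (BoundedContinuousFunction.norm_le (by positivity)).2 fun t => ?_
      change ‖h.d2 t + V.d2 (q.fn t) * h.fn t‖ ≤ _
      have h0 : ‖h.fn t‖ ≤ ‖h‖ := (h.fn.norm_coe_le_norm t).trans h.norm_fn_le
      have h2 : ‖h.d2 t‖ ≤ ‖h‖ := (h.d2.norm_coe_le_norm t).trans h.norm_d2_le
      have hV := V.d2.norm_coe_le_norm (q.fn t)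
      calc _ ≤ ‖h.d2 t‖ + ‖V.d2 (q.fn t)‖ * ‖h.fn t‖ := by
            rw [← norm_mul]; exact norm_add_le _ _
        _ ≤ ‖h‖ + ‖V.d2‖ * ‖h‖ := by gcongr
        _ = _ := by ring

/-- `F` is differentiable in `q`, so that `newtonPartial` is its genuine partial derivative. -/
theorem hasFDerivAt_newtonMap (T : ℝ) (q : CT2 T) (V : Potential) :
    HasFDerivAt (fun p : CT2 T => newtonMap T p V) (linearised T q V) q := by
  rw [hasFDerivAt_iff_isLittleO_nhds_zero, Asymptotics.isLittleO_iff]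
  intro ε hε
  have huc : UniformContinuousOn V.d2 (Metric.closedBall 0 (‖q.fn‖ + 1)) :=
    (isCompact_closedBall _ _).uniformContinuousOn_of_continuous V.d2.continuous.continuousOn
  obtain ⟨δ, hδ, H⟩ := Metric.uniformContinuousOn_iff.1 huc ε hε
  filter_upwards [Metric.ball_mem_nhds (0 : CT2 T) (lt_min hδ one_pos)] with h hh
  rw [mem_ball_zero_iff, lt_min_iff] at hh
  refine (BoundedContinuousFunction.norm_le (by positivity)).2 fun t => ?_
  change ‖(q.d2 t + h.d2 t + V.d1 (q.fn t + h.fn t)) - (q.d2 t + V.d1 (q.fn t)) -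
    (h.d2 t + V.d2 (q.fn t) * h.fn t)‖ ≤ _
  set a := q.fn t with ha
  set k := h.fn t with hk
  have hk' : ‖k‖ ≤ ‖h‖ := (h.fn.norm_coe_le_norm t).trans h.norm_fn_le
  have ha' : ‖a‖ ≤ ‖q.fn‖ := q.fn.norm_coe_le_norm t
  have hball : ∀ x ∈ Metric.closedBall a ‖k‖, ‖V.d2 x - V.d2 a‖ ≤ ε := fun x hx => by
    rw [mem_closedBall_iff_norm] at hx
    refine (H x ?_ a ?_ ?_).le
    · rw [mem_closedBall_zero_iff]
      have := norm_add_le (x - a) a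
      rw [sub_add_cancel] at this
      linarith
    · rw [mem_closedBall_zero_iff]; linarith
    · rw [dist_eq_norm]; linarith
  have hmv := (convex_closedBall a ‖k‖).norm_image_sub_le_of_norm_hasDerivWithin_le
    (f := fun x => V.d1 x - V.d2 a * x) (f' := fun x => V.d2 x - V.d2 a * 1)
    (C := ε) (x := a) (y := a + k)
    (fun x _ => ((V.hasDerivAt_d1 x).sub ((hasDerivAt_id x).const_mul (V.d2 a))).hasDerivWithinAt)
    (fun x hx => by simpa using hball x hx)
    (by simp) (by simp)
  have he : (q.d2 t + h.d2 t + V.d1 (a + k)) - (q.d2 t + V.d1 a) - (h.d2 t + V.d2 a * k) =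
      (V.d1 (a + k) - V.d2 a * (a + k)) - (V.d1 a - V.d2 a * a) := by ring
  rw [he]
  refine hmv.trans ?_
  rw [add_sub_cancel_left]
  gcongr

theorem newtonPartial_apply (T : ℝ) (q : CT2 T) (V : Potential) (h : CT2 T) (t : ℝ) :
    (newtonPartial T q V h).fn t = h.d2 t + V.d2 (q.fn t) * h.fn t := by
  rw [newtonPartial, (hasFDerivAt_newtonMap T q V).fderiv]
  rfl

/-- `V` is anharmonic at `q`: `q` is a nonconstant solution of Newton's equation in the
potential `V`, and the linearised operator has trivial kernel. -/
structure IsAnharmonic (T : ℝ) (V : Potential) (q : CT2 T) : Prop where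
  nonconstant : ¬ ∃ c : ℝ, ∀ t, q.fn t = c
  newton : newtonMap T q V = 0
  ker_eq_bot : (newtonPartial T q V).ker = ⊥

/-- `V` is degenerate at `q` (used for `T ∈ 2πℤ⁺`): it is anharmonic at `q` and
`∫₀ᵀ cos t · q(t) dt = 0`. -/
structure IsDegenerate (T : ℝ) (V : Potential) (q : CT2 T) : Prop where
  anharmonic : IsAnharmonic T V q
  integral_eq_zero : ∫ t in (0 : ℝ)..T, Real.cos t * q.fn t = 0

/-- `(U, f)` is a perturbation neighbourhood of `(q, V)`. (Values of `f` outside `U` are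
irrelevant.) -/
structure IsPerturbationNhd (T : ℝ) (q : CT2 T) (V : Potential)
    (U : Set Potential) (f : Potential → CT2 T) : Prop where
  isOpen : IsOpen U
  mem : V ∈ U
  contDiffOn : ContDiffOn ℝ 1 f U
  anharmonic : ∀ W ∈ U, IsAnharmonic T W (f W)
  map_base : f V = q

/-! ### Submanifolds of Banach spaces -/

/-- `S` is an (embedded) `C¹` submanifold of codimension `c` of the normed space `E`: around each
of its points there is a `C¹` chart of `E` (a homeomorphism between open subsets of `E`, `C¹` in
both directions) which carries `S` to a closed linear subspace of codimension `c`. For `c ≠ 0`,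
`Module.finrank` being `c` includes the finite dimensionality of the quotient, and a closed
subspace of finite codimension always splits. -/
def IsC1SubmanifoldOfCodim {E : Type*} [NormedAddCommGroup E] [NormedSpace ℝ E]
    (c : ℕ) (S : Set E) : Prop :=
  ∀ x ∈ S, ∃ (φ : OpenPartialHomeomorph E E) (H : Submodule ℝ E),
    x ∈ φ.source ∧ ContDiffOn ℝ 1 φ φ.source ∧ ContDiffOn ℝ 1 φ.symm φ.target ∧
    IsClosed (H : Set E) ∧ FiniteDimensional ℝ (E ⧸ H) ∧ Module.finrank ℝ (E ⧸ H) = c ∧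
    ∀ y ∈ φ.source, y ∈ S ↔ φ y ∈ H

/-! ### The sign of the off-central displacement across a resonance -/

/-- `x` is, for `τ` within `δ` of `T`, a continuous family (in the period `τ`) of even
`τ`-periodic solutions of Newton's equation in the potential `W`, passing through `q` at
`τ = T`. -/
structure IsPeriodFamily (T : ℝ) (W : Potential) (q : CT2 T) (δ : ℝ)
    (x : (τ : ℝ) → CT2 τ) : Prop where
  pos : 0 < δ
  newton : ∀ τ, |τ - T| < δ → newtonMap τ (x τ) W = 0
  continuousOn :
    ContinuousOn (fun p : ℝ × ℝ => (x p.1).fn p.2) {p : ℝ × ℝ | |p.1 - T| < δ}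
  base : x T = q

/-- `χ` is an even `τ`-periodic solution of `χ̈ + χ = x`. -/
def IsOffCentral {τ : ℝ} (x χ : CT2 τ) : Prop := ∀ t, χ.d2 t + χ.fn t = x.fn t

/-- For `τ ≠ T` close to `T` the equation `χ̈ + χ = x_τ` has exactly one even `τ`-periodic solution
`χ_τ`, and `χ_τ(0)` has (strictly) opposite signs on the two sides of `T`. -/
def HasSignChange (T : ℝ) (x : (τ : ℝ) → CT2 τ) : Prop :=
  ∃ ε > 0, (∀ τ, τ ≠ T → |τ - T| < ε → ∃! χ : CT2 τ, IsOffCentral (x τ) χ) ∧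
    ∀ τ₁ ∈ Set.Ioo (T - ε) T, ∀ τ₂ ∈ Set.Ioo T (T + ε), ∀ (χ₁ : CT2 τ₁) (χ₂ : CT2 τ₂),
      IsOffCentral (x τ₁) χ₁ → IsOffCentral (x τ₂) χ₂ → χ₁.fn 0 * χ₂.fn 0 < 0

end

open scoped BoundedContinuousFunction

noncomputable section

open Topology Filter

/-! ### Completeness of the space of potentials -/

/-! On `U` anharmonicity is automatic, so degeneracy is the single equation `g W = 0`, where `g W =
∫₀ᵀ cos t · f(W)(t) dt` is `C¹`. The submanifold property and density follow once `Dg` is shown to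
vanish nowhere on `U`.

Write `q = f(W)`. Differentiating `F(f(W), W) = 0` in a direction `X` shows that `-Df(W)X` is the
solution `k` of `k̈ + W''(q) k = X'(q)`, unique because the kernel is trivial. It is easier to
prescribe `k = Ψ(q)` and solve for `X`: energy conservation, `q̇² = 2(E - W(q))`, turns the equation
into `X = 2(E - W)Ψ' + W'Ψ`. For general `Ψ ∈ C²` this is only `C¹`, but with `v = √(2(E - W))` and
`Ψ = vζ` the terms without `ζ'` cancel, leaving `X = v³ζ'`, which is `C²`
(`exists_potentials_of_bump`).

If every period of `q` lies in `2πℤ`, then `cos t` depends only on the position `q(t)`. A bump `ζ`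
near `q(1)` therefore sees only times with `cos t > 0`, and `∫ cos t · k` is positive
(`exists_linearised_eq_and_cosCLM_pos`). This period condition holds at `q₀`, and it spreads over
the connected set `U` because both it and its negation are open conditions.

For the sign change, `χ(0) sin(τ/2) = ∫₀^{τ/2} cos(τ/2 - s) x_τ(s) ds`. The right side is continuous
in `τ` and nonzero at `T` off the degenerate set, while `sin(τ/2)` changes sign at `T`. -/

theorem isClosed_c2Bounded : IsClosed (c2Bounded : Set ((ℝ →ᵇ ℝ) × (ℝ →ᵇ ℝ) × (ℝ →ᵇ ℝ))) := by
  refine IsSeqClosed.isClosed fun j a hj ha => ?_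
  have h0 := BoundedContinuousFunction.tendsto_iff_tendstoUniformly.1
    ((continuous_fst.tendsto a).comp ha)
  have h1 := BoundedContinuousFunction.tendsto_iff_tendstoUniformly.1
    (((continuous_fst.comp continuous_snd).tendsto a).comp ha)
  have h2 := BoundedContinuousFunction.tendsto_iff_tendstoUniformly.1
    (((continuous_snd.comp continuous_snd).tendsto a).comp ha)
  exact ⟨hasDerivAt_of_tendstoUniformly h1 (Eventually.of_forall fun n => (hj n).1)
      fun x => h0.tendsto_at x,
    hasDerivAt_of_tendstoUniformly h2 (Eventually.of_forall fun n => (hj n).2)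
      fun x => h1.tendsto_at x⟩

instance : CompleteSpace Potential :=
  IsClosed.completeSpace_coe (hs := isClosed_c2Bounded)

/-! ### Zero sets of `C¹` functions with nonvanishing derivative -/

section RegularValue

variable {E : Type*} [NormedAddCommGroup E] [NormedSpace ℝ E]

theorem finrank_quotient_ker_eq_one (ℓ : E →L[ℝ] ℝ) {w : E} (hw : ℓ w = 1) :
    FiniteDimensional ℝ (E ⧸ ℓ.ker) ∧ Module.finrank ℝ (E ⧸ ℓ.ker) = 1 := by
  have hs : Function.Surjective (ℓ : E →ₗ[ℝ] ℝ) := fun c => ⟨c • w, by simp [hw]⟩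
  let e : (E ⧸ ℓ.ker) ≃ₗ[ℝ] ℝ := (ℓ : E →ₗ[ℝ] ℝ).quotKerEquivOfSurjective hs
  exact ⟨LinearEquiv.finiteDimensional e.symm, by rw [e.finrank_eq, Module.finrank_self]⟩

/-- If the derivative of `g` does not vanish at the point `x`, there are local coordinates at `x`
in which `g` is linear. -/
theorem exists_chart_of_fderiv_ne_zero [CompleteSpace E] {U : Set E} (hU : IsOpen U) {g : E → ℝ}
    (hg : ContDiffOn ℝ 1 g U) {x : E} (hx : x ∈ U) {w : E} (hw : fderiv ℝ g x w = 1) :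
    ∃ φ : OpenPartialHomeomorph E E, x ∈ φ.source ∧ φ.source ⊆ U ∧
      ContDiffOn ℝ 1 φ φ.source ∧ ContDiffOn ℝ 1 φ.symm φ.target ∧
      ∀ y ∈ φ.source, fderiv ℝ g x (φ y) = g y := by
  set ℓ := fderiv ℝ g x with hℓ
  -- Correcting along `w` gives `ℓ ∘ F = g` exactly, since `ℓ w = 1`, and makes the derivative of
  -- `F` at `x` the identity.
  let F : E → E := fun y => y + (g y - ℓ y) • w
  have hF : ContDiffOn ℝ 1 F U :=
    contDiffOn_id.add ((hg.sub ℓ.contDiff.contDiffOn).smul contDiffOn_const)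
  have hFat : ∀ y ∈ U, ContDiffAt ℝ 1 F y := fun y hy => hF.contDiffAt (hU.mem_nhds hy)
  have hF' : HasFDerivAt F ((ContinuousLinearEquiv.refl ℝ E : E ≃L[ℝ] E) : E →L[ℝ] E) x := by
    have h1 : HasFDerivAt g ℓ x :=
      ((hg.contDiffAt (hU.mem_nhds hx)).differentiableAt one_ne_zero).hasFDerivAt
    have h2 := (hasFDerivAt_id x).add ((h1.sub ℓ.hasFDerivAt).smul_const w)
    refine h2.congr_fderiv ?_
    ext v
    simp
  have hFx := hFat x hx
  let ψ := hFx.toOpenPartialHomeomorph F hF' one_ne_zero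
  have hψ : (ψ : E → E) = F := hFx.toOpenPartialHomeomorph_coe hF' one_ne_zero
  have hxψ : x ∈ ψ.source := hFx.mem_toOpenPartialHomeomorph_source hF' one_ne_zero
  have hcont : ContinuousOn (fderiv ℝ F) U := hF.continuousOn_fderiv_of_isOpen hU le_rfl
  -- The inverse function theorem gives a `C¹` inverse at one point; restricting to where `DF` is
  -- invertible makes it `C¹` on the whole target.
  let O := U ∩ fderiv ℝ F ⁻¹' (Set.range ((↑) : (E ≃L[ℝ] E) → (E →L[ℝ] E)))
  have hO : IsOpen O := hcont.isOpen_inter_preimage hU ContinuousLinearEquiv.isOpen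
  have hxO : x ∈ O := ⟨hx, ⟨_, hF'.fderiv.symm⟩⟩
  let φ := ψ.restrOpen O hO
  have hφ : (φ : E → E) = F := hψ
  have hsrc : φ.source = ψ.source ∩ O := rfl
  have hFℓ : ∀ y, ℓ (F y) = g y := fun y => by
    simp only [F, map_add, map_smul, hw, smul_eq_mul, mul_one]; ring
  refine ⟨φ, ⟨hxψ, hxO⟩, fun y hy => hy.2.1, ?_, ?_, fun y _ => by rw [hφ, hFℓ]⟩
  · rw [hφ]; exact hF.mono fun y hy => hy.2.1
  · intro z hz
    have hz' := φ.map_target hz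
    obtain ⟨e, he⟩ := hz'.2.2
    refine (φ.contDiffAt_symm hz (f₀' := e) ?_ ?_).contDiffWithinAt
    · rw [hφ]
      change HasFDerivAt F (e : E →L[ℝ] E) _
      rw [he]
      exact ((hFat _ hz'.2.1).differentiableAt one_ne_zero).hasFDerivAt
    · rw [hφ]; exact hFat _ hz'.2.1

theorem isC1SubmanifoldOfCodim_zeroSet [CompleteSpace E] {U : Set E} (hU : IsOpen U) {g : E → ℝ}
    (hg : ContDiffOn ℝ 1 g U) (hreg : ∀ x ∈ U, g x = 0 → fderiv ℝ g x ≠ 0) :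
    IsC1SubmanifoldOfCodim 1 {x ∈ U | g x = 0} := by
  rintro x ⟨hx, hx0⟩
  obtain ⟨v, hv⟩ : ∃ v, fderiv ℝ g x v ≠ 0 := by
    by_contra! h
    exact hreg x hx hx0 (ContinuousLinearMap.ext h)
  have hw : fderiv ℝ g x ((fderiv ℝ g x v)⁻¹ • v) = 1 := by
    rw [map_smul, smul_eq_mul, inv_mul_cancel₀ hv]
  obtain ⟨φ, hxφ, hφU, h1, h2, h3⟩ := exists_chart_of_fderiv_ne_zero hU hg hx hw
  obtain ⟨h4, h5⟩ := finrank_quotient_ker_eq_one _ hw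
  refine ⟨φ, (fderiv ℝ g x).ker, hxφ, h1, h2, (fderiv ℝ g x).isClosed_ker, h4, h5,
    fun y hy => ?_⟩
  rw [LinearMap.mem_ker]
  change (y ∈ U ∧ g y = 0) ↔ fderiv ℝ g x (φ y) = 0
  rw [h3 y hy]
  exact and_iff_right (hφU hy)

theorem subset_closure_ne_zero {U : Set E} (hU : IsOpen U) {g : E → ℝ}
    (hreg : ∀ x ∈ U, g x = 0 → fderiv ℝ g x ≠ 0) :
    U ⊆ closure {x ∈ U | g x ≠ 0} := by
  intro x hx
  by_contra hcl
  have hev : ∀ᶠ y in 𝓝 x, g y = 0 := by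
    filter_upwards [hU.mem_nhds hx, isClosed_closure.isOpen_compl.mem_nhds hcl] with y hy hy'
    by_contra h
    exact hy' (subset_closure ⟨hy, h⟩)
  refine hreg x hx hev.self_of_nhds ?_
  rw [(show g =ᶠ[𝓝 x] fun _ => 0 from hev).fderiv_eq]
  simp

end RegularValue

/-! ### Newton's equation in a potential -/

namespace Potential

theorem lipschitzWith_d1 (V : Potential) : LipschitzWith ‖V.d2‖₊ V.d1 := by
  refine lipschitzWith_of_nnnorm_deriv_le (fun x => (V.hasDerivAt_d1 x).differentiableAt)
    fun x => ?_
  rw [V.deriv_d1]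
  exact V.d2.norm_coe_le_norm x

/-- Since `V''` is bounded, the phase-space field `(q, p) ↦ (p, -V'(q))` is globally Lipschitz. Bare
functions are allowed so that translates and equilibria can be compared with `q`. -/
theorem newton_unique (V : Potential) {q q' r r' : ℝ → ℝ} (hq : ∀ t, HasDerivAt q (q' t) t)
    (hq' : ∀ t, HasDerivAt q' (-V.d1 (q t)) t) (hr : ∀ t, HasDerivAt r (r' t) t)
    (hr' : ∀ t, HasDerivAt r' (-V.d1 (r t)) t) {t₀ : ℝ} (h0 : q t₀ = r t₀)
    (h1 : q' t₀ = r' t₀) (t : ℝ) : q t = r t := by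
  have hLip : ∀ s : ℝ, LipschitzOnWith (max 1 ‖V.d2‖₊)
      ((fun _ p => (p.2, -V.d1 p.1)) s : ℝ × ℝ → ℝ × ℝ) ((fun _ => Set.univ) s) := fun s => by
    refine LipschitzWith.lipschitzOnWith ?_
    have h := (V.lipschitzWith_d1.comp (LipschitzWith.prod_fst (α := ℝ) (β := ℝ))).neg
    rw [mul_one] at h
    exact LipschitzWith.prod_snd.prodMk h
  have := ODE_solution_unique_univ (f := fun s => (q s, q' s)) (g := fun s => (r s, r' s)) hLip
    (fun s => ⟨(hq s).prodMk (hq' s), trivial⟩) (fun s => ⟨(hr s).prodMk (hr' s), trivial⟩)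
    (Prod.ext h0 h1 : (q t₀, q' t₀) = (r t₀, r' t₀))
  exact congrArg Prod.fst (congrFun this t)

theorem ext_fn {V W : Potential} (h : ∀ t, V.fn t = W.fn t) : V = W := by
  have h0 : V.fn = W.fn := BoundedContinuousFunction.ext h
  have h1 : V.d1 = W.d1 := by
    apply DFunLike.coe_injective; rw [← V.deriv_fn, ← W.deriv_fn, h0]
  have h2 : V.d2 = W.d2 := by
    apply DFunLike.coe_injective; rw [← V.deriv_d1, ← W.deriv_d1, h1]
  exact Subtype.ext (Prod.ext h0 (Prod.ext h1 h2))

/-- The composition of two elements of `𝒫`. -/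
def comp (Ψ q : Potential) : Potential :=
  ⟨(Ψ.fn.compContinuous q.fn.toContinuousMap,
    Ψ.d1.compContinuous q.fn.toContinuousMap * q.d1,
    Ψ.d2.compContinuous q.fn.toContinuousMap * q.d1 * q.d1 +
      Ψ.d1.compContinuous q.fn.toContinuousMap * q.d2),
    fun t => (Ψ.hasDerivAt_fn (q.fn t)).comp t (q.hasDerivAt_fn t),
    fun t => (((Ψ.hasDerivAt_d1 (q.fn t)).comp t (q.hasDerivAt_fn t)).mul
      (q.hasDerivAt_d1 t))⟩

theorem exists_fn_eq_of_hasCompactSupport {g : ℝ → ℝ} (hg : ContDiff ℝ 2 g)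
    (hs : HasCompactSupport g) : ∃ V : Potential, ∀ x, V.fn x = g x := by
  have hg1 : ContDiff ℝ 1 (deriv g) := by
    rw [show (2 : WithTop ℕ∞) = 1 + 1 by norm_num, contDiff_succ_iff_deriv] at hg
    exact hg.2.2
  have hg2 : Continuous (deriv (deriv g)) := hg1.continuous_deriv le_rfl
  obtain ⟨A, hA⟩ := hs.exists_bound_of_continuous hg.continuous
  obtain ⟨B, hB⟩ := hs.deriv.exists_bound_of_continuous hg1.continuous
  obtain ⟨C, hC⟩ := hs.deriv.deriv.exists_bound_of_continuous hg2
  obtain ⟨V, hV⟩ := (Potential.exists_fn_eq_iff g).2 ⟨hg, max A (max B C), fun x =>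
    ⟨(hA x).trans (le_max_left _ _), (hB x).trans (by simp), (hC x).trans (by simp)⟩⟩
  exact ⟨V, congrFun hV⟩

end Potential

namespace CT2

variable {T : ℝ}

/-- The first derivative `q̇`. -/
def d1 (q : CT2 T) : ℝ →ᵇ ℝ := q.1.d1

theorem hasDerivAt_fn (q : CT2 T) (t : ℝ) : HasDerivAt q.fn (q.d1 t) t := q.1.hasDerivAt_fn t

theorem hasDerivAt_d1 (q : CT2 T) (t : ℝ) : HasDerivAt q.d1 (q.d2 t) t := q.1.hasDerivAt_d1 t

theorem d1_neg (q : CT2 T) (t : ℝ) : q.d1 (-t) = -q.d1 t := by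
  have h := (q.hasDerivAt_fn (-t)).scomp t (hasDerivAt_neg t)
  rw [show (q.fn : ℝ → ℝ) ∘ Neg.neg = q.fn from funext q.even_fn] at h
  have := h.unique (q.hasDerivAt_fn t)
  simp only [smul_eq_mul] at this
  linarith

theorem d1_add_of_periodic (q : CT2 T) {p : ℝ} (hp : Function.Periodic q.fn p) (t : ℝ) :
    q.d1 (t + p) = q.d1 t := by
  have h := (q.hasDerivAt_fn (t + p)).comp_add_const t p
  rw [show (fun x => q.fn (x + p)) = q.fn from funext hp] at h
  exact h.unique (q.hasDerivAt_fn t)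

theorem d1_half_of_periodic (q : CT2 T) {p : ℝ} (hp : Function.Periodic q.fn p) :
    q.d1 (p / 2) = 0 := by
  have h := q.d1_add_of_periodic hp (-(p / 2))
  rw [q.d1_neg, show -(p / 2) + p = p / 2 by ring] at h
  linarith

theorem ext_fn {q r : CT2 T} (h : ∀ t, q.fn t = r.fn t) : q = r :=
  Subtype.ext (Potential.ext_fn h)

/-- The composition of an even periodic function with a potential. -/
def comp (Ψ : Potential) (q : CT2 T) : CT2 T :=
  ⟨Ψ.comp q.1, fun t => congrArg Ψ.fn (q.periodic_fn t), fun t => congrArg Ψ.fn (q.even_fn t)⟩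

@[simp] theorem comp_fn (Ψ : Potential) (q : CT2 T) (t : ℝ) :
    (comp Ψ q).fn t = Ψ.fn (q.fn t) := rfl

theorem comp_d2 (Ψ : Potential) (q : CT2 T) (t : ℝ) :
    (comp Ψ q).d2 t = Ψ.d2 (q.fn t) * q.d1 t * q.d1 t + Ψ.d1 (q.fn t) * q.d2 t := rfl

theorem norm_d1_le (q : CT2 T) : ‖q.d1‖ ≤ ‖q‖ := (le_max_left _ _).trans (le_max_right _ _)

/-- Evaluation `q ↦ q t`. -/
def evalCLM (T t : ℝ) : CT2 T →L[ℝ] ℝ :=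
  LinearMap.mkContinuous
    { toFun := fun q => q.fn t
      map_add' := fun _ _ => rfl
      map_smul' := fun _ _ => rfl }
    1 fun q => by
      rw [one_mul]; exact (q.fn.norm_coe_le_norm t).trans q.norm_fn_le

/-- Evaluation `q ↦ q̈ t` of the second derivative. -/
def evalD2CLM (T t : ℝ) : CT2 T →L[ℝ] ℝ :=
  LinearMap.mkContinuous
    { toFun := fun q => q.d2 t
      map_add' := fun _ _ => rfl
      map_smul' := fun _ _ => rfl }
    1 fun q => by
      rw [one_mul]; exact (q.d2.norm_coe_le_norm t).trans q.norm_d2_le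

/-- The cosine coefficient `q ↦ ∫₀ᵀ cos t · q t dt`. -/
def cosCLM (T : ℝ) : CT2 T →L[ℝ] ℝ :=
  LinearMap.mkContinuous
    { toFun := fun q => ∫ t in (0 : ℝ)..T, Real.cos t * q.fn t
      map_add' := fun q r => by
        rw [← intervalIntegral.integral_add]
        · exact intervalIntegral.integral_congr fun t _ => mul_add _ _ _
        · exact (Real.continuous_cos.mul q.fn.continuous).intervalIntegrable _ _
        · exact (Real.continuous_cos.mul r.fn.continuous).intervalIntegrable _ _
      map_smul' := fun c q => by
        rw [RingHom.id_apply, smul_eq_mul, ← intervalIntegral.integral_const_mul]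
        exact intervalIntegral.integral_congr fun t _ => mul_left_comm _ _ _ }
    |T| fun q => by
      refine (intervalIntegral.norm_integral_le_of_norm_le_const (C := ‖q‖) fun t _ => ?_).trans
        (le_of_eq ?_)
      · rw [norm_mul]
        calc _ ≤ 1 * ‖q‖ := mul_le_mul (Real.abs_cos_le_one t)
              ((q.fn.norm_coe_le_norm t).trans q.norm_fn_le) (norm_nonneg _) zero_le_one
          _ = ‖q‖ := one_mul _
      · rw [sub_zero, mul_comm]

theorem cosCLM_apply (q : CT2 T) : cosCLM T q = ∫ t in (0 : ℝ)..T, Real.cos t * q.fn t := rfl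

end CT2

/-! ### Nonconstant even periodic solutions -/

section Solutions

variable {T : ℝ} {V : Potential} {q : CT2 T}

theorem d2_eq_of_newton (h : newtonMap T q V = 0) (t : ℝ) : q.d2 t = -V.d1 (q.fn t) := by
  have : (newtonMap T q V).fn t = 0 := by rw [h]; rfl
  rw [newtonMap_apply] at this
  linarith

theorem hasDerivAt_d1_of_newton (h : newtonMap T q V = 0) (t : ℝ) :
    HasDerivAt q.d1 (-V.d1 (q.fn t)) t := d2_eq_of_newton h t ▸ q.hasDerivAt_d1 t

theorem energy_eq (h : newtonMap T q V = 0) (t s : ℝ) :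
    q.d1 t ^ 2 / 2 + V.fn (q.fn t) = q.d1 s ^ 2 / 2 + V.fn (q.fn s) := by
  refine is_const_of_deriv_eq_zero (f := fun t => q.d1 t ^ 2 / 2 + V.fn (q.fn t))
    (fun t => ?_) (fun t => ?_) t s
  all_goals
    have hd := (((hasDerivAt_d1_of_newton h t).pow 2).div_const 2).add
      ((V.hasDerivAt_fn (q.fn t)).comp t (q.hasDerivAt_fn t))
  · exact hd.differentiableAt
  · refine hd.deriv.trans ?_
    simp; ring

/-- Times with the same position differ by a period up to the reflection `t ↦ -t`. -/
theorem periodic_sub_or_add (h : newtonMap T q V = 0) {t s : ℝ} (hts : q.fn t = q.fn s) :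
    Function.Periodic q.fn (t - s) ∨ Function.Periodic q.fn (t + s) := by
  -- Equal positions force velocities equal up to sign; the minus sign is absorbed by the symmetry
  -- `q(-s) = q(s)`.
  have he := energy_eq h t s
  rw [hts] at he
  rcases sq_eq_sq_iff_eq_or_eq_neg.1 (show q.d1 t ^ 2 = q.d1 s ^ 2 by linarith) with h1 | h1
  · left
    intro r
    refine V.newton_unique (q := fun x => q.fn (x + (t - s))) (q' := fun x => q.d1 (x + (t - s)))
      (r := q.fn) (r' := q.d1) (t₀ := s)
      (fun x => (q.hasDerivAt_fn _).comp_add_const x (t - s))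
      (fun x => (hasDerivAt_d1_of_newton h _).comp_add_const x (t - s))
      q.hasDerivAt_fn (hasDerivAt_d1_of_newton h) ?_ ?_ r
    · simpa using hts
    · simpa using h1
  · right
    intro r
    refine V.newton_unique (q := fun x => q.fn (x + (t + s))) (q' := fun x => q.d1 (x + (t + s)))
      (r := q.fn) (r' := q.d1) (t₀ := -s)
      (fun x => (q.hasDerivAt_fn _).comp_add_const x (t + s))
      (fun x => (hasDerivAt_d1_of_newton h _).comp_add_const x (t + s))
      q.hasDerivAt_fn (hasDerivAt_d1_of_newton h) ?_ ?_ r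
    · simp only [neg_add_eq_sub, add_sub_cancel_right]
      rw [q.even_fn, hts]
    · simp only [neg_add_eq_sub, add_sub_cancel_right]
      rw [q.d1_neg, h1]

theorem d1_eq_zero_iff_periodic (h : newtonMap T q V = 0) (t : ℝ) :
    q.d1 t = 0 ↔ Function.Periodic q.fn (2 * t) := by
  constructor
  · intro h0 r
    refine V.newton_unique (q := fun x => q.fn (x + 2 * t)) (q' := fun x => q.d1 (x + 2 * t))
      (r := q.fn) (r' := q.d1) (t₀ := -t)
      (fun x => (q.hasDerivAt_fn _).comp_add_const x (2 * t))
      (fun x => (hasDerivAt_d1_of_newton h _).comp_add_const x (2 * t))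
      q.hasDerivAt_fn (hasDerivAt_d1_of_newton h) ?_ ?_ r
    · rw [q.even_fn]; congr 1; ring
    · rw [q.d1_neg, h0, neg_zero, show -t + 2 * t = t by ring, h0]
  · intro hp
    simpa using q.d1_half_of_periodic hp

/-- Otherwise `q` would share its initial data with an equilibrium. Hence the zeros of `q̇` are
simple. -/
theorem d2_ne_zero_of_d1_eq_zero (h : newtonMap T q V = 0)
    (hnc : ¬ ∃ c : ℝ, ∀ t, q.fn t = c) {t : ℝ} (ht : q.d1 t = 0) : q.d2 t ≠ 0 := by
  intro h2
  have hV : V.d1 (q.fn t) = 0 := by have := d2_eq_of_newton h t; linarith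
  refine hnc ⟨q.fn t, V.newton_unique (r := fun _ => q.fn t) (r' := fun _ => 0) (t₀ := t)
    q.hasDerivAt_fn (hasDerivAt_d1_of_newton h) (fun s => hasDerivAt_const s _) (fun s => ?_)
    rfl ht⟩
  rw [hV, neg_zero]
  exact hasDerivAt_const s _

theorem cos_eq_cos_of_fn_eq (h : newtonMap T q V = 0)
    (hper : ∀ p : ℝ, Function.Periodic q.fn p → ∃ m : ℤ, p = 2 * Real.pi * m) {t s : ℝ}
    (hts : q.fn t = q.fn s) : Real.cos t = Real.cos s := by
  rw [Real.cos_eq_cos_iff]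
  rcases periodic_sub_or_add h hts with hp | hp <;> obtain ⟨m, hm⟩ := hper _ hp
  · exact ⟨-m, Or.inl (by push_cast; linarith)⟩
  · exact ⟨m, Or.inr (by linarith)⟩

end Solutions

/-! ### Persistence of the resonance condition -/

/-- While `|sin x| < 1/2` one has `|cos x| ≥ 3/4`, so doubling the angle expands `|sin|` by a factor
at least `3/2`; a nonzero value would eventually leave the range. -/
theorem sin_eq_zero_of_forall_abs_sin_lt {t : ℝ} (h : ∀ k : ℕ, |Real.sin (2 ^ k * t)| < 1 / 2) :
    Real.sin t = 0 := by
  have hstep : ∀ x, |Real.sin x| < 1 / 2 → 3 / 2 * |Real.sin x| ≤ |Real.sin (2 * x)| := by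
    intro x hx
    rw [Real.sin_two_mul, abs_mul, abs_mul, abs_two]
    have h1 := Real.sin_sq_add_cos_sq x
    rw [← sq_abs (Real.sin x), ← sq_abs (Real.cos x)] at h1
    have h2 : 3 / 4 ≤ |Real.cos x| := by
      nlinarith [abs_nonneg (Real.sin x), abs_nonneg (Real.cos x)]
    nlinarith [abs_nonneg (Real.sin x)]
  have hpow : ∀ k : ℕ, (3 / 2 : ℝ) ^ k * |Real.sin t| ≤ |Real.sin (2 ^ k * t)| := by
    intro k
    induction k with
    | zero => simp
    | succ k ih =>
      have := hstep _ (h k)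
      rw [← mul_assoc, ← pow_succ'] at this
      rw [pow_succ']
      linarith
  by_contra hne
  have hlim := (tendsto_pow_atTop_atTop_of_one_lt (r := (3 / 2 : ℝ)) (by norm_num)).atTop_mul_const
    (abs_pos.2 hne)
  obtain ⟨k, hk⟩ := (hlim.eventually_ge_atTop (1 / 2)).exists
  linarith [hpow k, h k]

/-- All periods of `q` are integer multiples of `2π`. -/
def HasResonantPeriods {T : ℝ} (q : CT2 T) : Prop :=
  ∀ p : ℝ, Function.Periodic q.fn p → ∃ m : ℤ, p = 2 * Real.pi * m

theorem CT2.continuous_d1 {T : ℝ} : Continuous (CT2.d1 : CT2 T → ℝ →ᵇ ℝ) :=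
  (continuous_fst.comp continuous_snd).comp (continuous_subtype_val.comp continuous_subtype_val)

section Persistence

variable {T : ℝ}

/-- The zeros of `q̇` are exactly the half-periods, so the condition becomes one on the zeros of
`q̇`, which can be followed under perturbation. -/
theorem hasResonantPeriods_iff {V : Potential} {q : CT2 T} (h : newtonMap T q V = 0) :
    HasResonantPeriods q ↔ ∀ t, q.d1 t = 0 → Real.sin t = 0 := by
  constructor
  · intro hP t ht
    obtain ⟨m, hm⟩ := hP _ ((d1_eq_zero_iff_periodic h t).1 ht)
    exact Real.sin_eq_zero_iff.2 ⟨m, by linarith⟩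
  · intro hs p hp
    obtain ⟨m, hm⟩ := Real.sin_eq_zero_iff.1 (hs _ (q.d1_half_of_periodic hp))
    exact ⟨m, by linarith⟩

/-- A `C¹`-small perturbation creates no zeros of the velocity where `|sin| ≥ 1/2`. This rough bound
suffices: half-periods are closed under doubling, so all `2 ^ k * t` obey it as well. -/
theorem HasResonantPeriods.eventually {n : ℕ} (hn : 0 < n) (hT : T = 2 * Real.pi * n)
    {V : Potential} {q : CT2 T} (h : newtonMap T q V = 0) (hP : HasResonantPeriods q) :
    ∀ᶠ r in 𝓝 q, ∀ W : Potential, newtonMap T r W = 0 → HasResonantPeriods r := by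
  have hTpos : 0 < T := by rw [hT]; positivity
  rw [hasResonantPeriods_iff h] at hP
  have hK : IsCompact (Set.Icc 0 T ∩ {t | 1 / 2 ≤ |Real.sin t|}) :=
    isCompact_Icc.inter_right (isClosed_le continuous_const Real.continuous_sin.abs)
  obtain ⟨c, hc, hcK⟩ := hK.exists_forall_le' (f := fun t => |q.d1 t|)
    q.d1.continuous.abs.continuousOn (a := 0) fun t ht => abs_pos.2 fun h0 => by
      have := ht.2
      rw [Set.mem_ofPred_eq, hP t h0, abs_zero] at this
      norm_num at this
  filter_upwards [Metric.ball_mem_nhds q hc] with r hr W hW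
  rw [mem_ball_iff_norm] at hr
  have hne : ∀ t ∈ Set.Icc 0 T ∩ {t | 1 / 2 ≤ |Real.sin t|}, r.d1 t ≠ 0 := by
    intro t ht h0
    have h1 : |r.d1 t - q.d1 t| ≤ ‖r - q‖ :=
      ((r - q).d1.norm_coe_le_norm t).trans (r - q).norm_d1_le
    rw [h0, zero_sub, abs_neg] at h1
    linarith [hcK t ht]
  have hlt : ∀ t, r.d1 t = 0 → |Real.sin t| < 1 / 2 := by
    intro t h0
    by_contra! hge
    -- As `T` is a multiple of `2π`, velocity and sine are reduced to `[0, T)` simultaneously.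
    have hpair : Function.Periodic (fun t => (r.d1 t, Real.sin t)) T := fun t =>
      Prod.ext (r.d1_add_of_periodic r.periodic_fn t) (by
        change Real.sin (t + T) = Real.sin t
        rw [show t + T = t + n * (2 * Real.pi) by rw [hT]; ring, Real.sin_add_nat_mul_two_pi])
    obtain ⟨y, hy, hyt⟩ := hpair.exists_mem_Ico₀ hTpos t
    obtain ⟨hy1, hy2⟩ := Prod.ext_iff.1 hyt
    exact hne y ⟨Set.Ico_subset_Icc_self hy, hge.trans_eq (congrArg abs hy2)⟩ (hy1.symm.trans h0)
  rw [hasResonantPeriods_iff hW]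
  refine fun t ht => sin_eq_zero_of_forall_abs_sin_lt fun k => hlt _ ?_
  rw [d1_eq_zero_iff_periodic hW] at ht ⊢
  have := ht.nat_mul (2 ^ k)
  rwa [show ((2 ^ k : ℕ) : ℝ) * (2 * t) = 2 * (2 ^ k * t) by push_cast; ring] at this

/-- A zero of `q̇` with `sin t ≠ 0` is simple, so it persists nearby by the intermediate value
theorem. -/
theorem eventually_not_hasResonantPeriods {V : Potential} {q : CT2 T}
    (h : newtonMap T q V = 0) (hnc : ¬ ∃ c : ℝ, ∀ t, q.fn t = c) (hP : ¬ HasResonantPeriods q) :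
    ∀ᶠ r in 𝓝 q, ∀ W : Potential, newtonMap T r W = 0 → ¬ HasResonantPeriods r := by
  rw [hasResonantPeriods_iff h] at hP
  push Not at hP
  obtain ⟨t, ht, hst⟩ := hP
  set c := q.d2 t with hc
  have hc0 : c ≠ 0 := d2_ne_zero_of_d1_eq_zero h hnc ht
  -- Multiplying by `c = q̈ t` treats both signs of `q̈ t` at once: `q̇ · c` passes from negative to
  -- positive.
  have hslope : ∀ᶠ s in 𝓝[≠] t, 0 < slope q.d1 t s * c := by
    have := ((hasDerivAt_iff_tendsto_slope.1 (q.hasDerivAt_d1 t)).mul_const c)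
    exact this.eventually_const_lt (mul_self_pos.2 hc0)
  rw [eventually_nhdsWithin_iff] at hslope
  obtain ⟨ε, hε, H⟩ := Metric.eventually_nhds_iff.1
    (hslope.and (Real.continuous_sin.continuousAt.eventually_ne hst))
  have ha := (H (y := t - ε / 2) (by rw [Real.dist_eq]; simp; rw [abs_of_pos] <;> linarith)).1
    (by simp; linarith)
  have hb := (H (y := t + ε / 2) (by rw [Real.dist_eq]; simp; rw [abs_of_pos] <;> linarith)).1
    (by simp; linarith)
  have hsin : ∀ s ∈ Set.Icc (t - ε / 2) (t + ε / 2), Real.sin s ≠ 0 := fun s hs =>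
    (H (by rw [Real.dist_eq, abs_lt]; constructor <;> linarith [hs.1, hs.2])).2
  rw [slope_def_field, ht] at ha hb
  have ha' : q.d1 (t - ε / 2) * c < 0 := by
    have : q.d1 (t - ε / 2) * c =
      -(ε / 2) * ((q.d1 (t - ε / 2) - 0) / (t - ε / 2 - t) * c) := by
        rw [show t - ε / 2 - t = -(ε / 2) by ring]; field_simp; ring
    rw [this]; nlinarith
  have hb' : 0 < q.d1 (t + ε / 2) * c := by
    have : q.d1 (t + ε / 2) * c =
      (ε / 2) * ((q.d1 (t + ε / 2) - 0) / (t + ε / 2 - t) * c) := by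
        rw [show t + ε / 2 - t = ε / 2 by ring]; field_simp; ring
    rw [this]; positivity
  have hev : ∀ s : ℝ, Continuous fun r : CT2 T => r.d1 s * c := fun s =>
    ((continuous_eval_const (F := ℝ →ᵇ ℝ) s).comp CT2.continuous_d1).mul_const c
  filter_upwards [(hev (t - ε / 2)).continuousAt.eventually_lt continuousAt_const ha',
    continuousAt_const.eventually_lt (hev (t + ε / 2)).continuousAt hb'] with r hra hrb W hW
  rw [hasResonantPeriods_iff hW]
  push Not
  obtain ⟨s, hs, hs0⟩ := intermediate_value_Icc (by linarith : t - ε / 2 ≤ t + ε / 2)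
    (r.d1.continuous.mul_const c).continuousOn (show (0 : ℝ) ∈ _ from ⟨hra.le, hrb.le⟩)
  exact ⟨s, (mul_eq_zero.1 hs0).resolve_right hc0, hsin s hs⟩

theorem IsPerturbationNhd.hasResonantPeriods {n : ℕ} (hn : 0 < n) (hT : T = 2 * Real.pi * n)
    {V₀ : Potential} {q₀ : CT2 T} (hper : HasResonantPeriods q₀) {U : Set Potential}
    {f : Potential → CT2 T} (hUf : IsPerturbationNhd T q₀ V₀ U f) (hU : IsPreconnected U)
    {W : Potential} (hW : W ∈ U) : HasResonantPeriods (f W) := by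
  have hcont : ∀ W ∈ U, ContinuousAt f W := fun W hW =>
    hUf.contDiffOn.continuousOn.continuousAt (hUf.isOpen.mem_nhds hW)
  have hA : IsOpen {W ∈ U | HasResonantPeriods (f W)} := isOpen_iff_mem_nhds.2 fun W hW => by
    filter_upwards [(hcont W hW.1).eventually (hW.2.eventually hn hT
      (hUf.anharmonic W hW.1).newton), hUf.isOpen.mem_nhds hW.1] with X hX hXU
    exact ⟨hXU, hX X (hUf.anharmonic X hXU).newton⟩
  have hB : IsOpen {W ∈ U | ¬ HasResonantPeriods (f W)} := isOpen_iff_mem_nhds.2 fun W hW => by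
    filter_upwards [(hcont W hW.1).eventually (eventually_not_hasResonantPeriods
      (hUf.anharmonic W hW.1).newton (hUf.anharmonic W hW.1).nonconstant hW.2),
      hUf.isOpen.mem_nhds hW.1] with X hX hXU
    exact ⟨hXU, hX X (hUf.anharmonic X hXU).newton⟩
  refine (hU.subset_left_of_subset_union hA hB
    (Set.disjoint_left.2 fun X hX hX' => hX'.2 hX.2) (fun X hX => ?_)
    ⟨V₀, hUf.mem, hUf.mem, hUf.map_base ▸ hper⟩ hW).2
  by_cases h : HasResonantPeriods (f X)
  · exact Or.inl ⟨hX, h⟩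
  · exact Or.inr ⟨hX, h⟩

/-! ### The derivative of the solution with respect to the potential -/

theorem IsPerturbationNhd.linearised_fderiv {V₀ : Potential} {q₀ : CT2 T} {U : Set Potential}
    {f : Potential → CT2 T} (hUf : IsPerturbationNhd T q₀ V₀ U f) {W : Potential} (hW : W ∈ U)
    (X : Potential) (t : ℝ) :
    (fderiv ℝ f W X).d2 t + W.d2 ((f W).fn t) * (fderiv ℝ f W X).fn t =
      -X.d1 ((f W).fn t) := by
  have hf : HasFDerivAt f (fderiv ℝ f W) W := ((hUf.contDiffOn.contDiffAt
    (hUf.isOpen.mem_nhds hW)).differentiableAt one_ne_zero).hasFDerivAt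
  -- Newton's equation is differentiated along a line of potentials at a fixed time, so joint
  -- differentiability of `F` is not needed.
  have hline : HasDerivAt (fun s : ℝ => W + s • X) X 0 := by
    simpa using ((hasDerivAt_id (0 : ℝ)).smul_const X).const_add W
  have hf0 : HasFDerivAt f (fderiv ℝ f W) (W + (0 : ℝ) • X) := by simpa using hf
  have hk : HasDerivAt (fun s : ℝ => f (W + s • X)) (fderiv ℝ f W X) 0 :=
    hf0.comp_hasDerivAt 0 hline
  have h2 : HasDerivAt (fun s : ℝ => (f (W + s • X)).d2 t) ((fderiv ℝ f W X).d2 t) 0 :=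
    (CT2.evalD2CLM T t).hasFDerivAt.comp_hasDerivAt 0 hk
  have h0 : HasDerivAt (fun s : ℝ => (f (W + s • X)).fn t) ((fderiv ℝ f W X).fn t) 0 :=
    (CT2.evalCLM T t).hasFDerivAt.comp_hasDerivAt 0 hk
  have hbase : (f (W + (0 : ℝ) • X)).fn t = (f W).fn t := by simp
  have h3 := (hbase ▸ W.hasDerivAt_d1 ((f W).fn t)).comp (0 : ℝ) h0
  have h4 := (hasDerivAt_id (0 : ℝ)).mul ((X.hasDerivAt_d1 _).comp (0 : ℝ) h0)
  have hsum := (h2.add h3).add h4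
  have hzero : ∀ᶠ s : ℝ in 𝓝 0, (f (W + s • X)).d2 t + W.d1 ((f (W + s • X)).fn t) +
      s * X.d1 ((f (W + s • X)).fn t) = 0 := by
    have hU0 : U ∈ 𝓝 (W + (0 : ℝ) • X) := by simpa using hUf.isOpen.mem_nhds hW
    filter_upwards [hline.continuousAt.eventually hU0] with s hs
    have := d2_eq_of_newton (hUf.anharmonic _ hs).newton t
    rw [this]
    change -(W.d1 _ + s * X.d1 _) + _ + _ = _
    ring
  have := hsum.unique ((hasDerivAt_const (0 : ℝ) (0 : ℝ)).congr_of_eventuallyEq hzero)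
  simp only [id, Function.comp, hbase, one_mul, zero_mul, add_zero] at this
  linarith

theorem IsPerturbationNhd.fderiv_eq_neg {V₀ : Potential} {q₀ : CT2 T} {U : Set Potential}
    {f : Potential → CT2 T} (hUf : IsPerturbationNhd T q₀ V₀ U f) {W : Potential} (hW : W ∈ U)
    {X : Potential} {k : CT2 T}
    (hk : ∀ t, k.d2 t + W.d2 ((f W).fn t) * k.fn t = X.d1 ((f W).fn t)) :
    fderiv ℝ f W X = -k := by
  have hmem : fderiv ℝ f W X + k ∈ (newtonPartial T (f W) W).ker := by
    rw [LinearMap.mem_ker]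
    refine Subtype.ext (BoundedContinuousFunction.ext fun t => ?_)
    refine (newtonPartial_apply T (f W) W (fderiv ℝ f W X + k) t).trans ?_
    change (fderiv ℝ f W X).d2 t + k.d2 t + W.d2 ((f W).fn t) *
      ((fderiv ℝ f W X).fn t + k.fn t) = 0
    linarith [hk t, hUf.linearised_fderiv hW X t]
  rw [(hUf.anharmonic W hW).ker_eq_bot, Submodule.mem_bot] at hmem
  exact eq_neg_of_add_eq_zero_left hmem

end Persistence

/-! ### Potentials which move the cosine coefficient -/

theorem contDiff_of_forall_mem_tsupport {n : WithTop ℕ∞} {g ζ : ℝ → ℝ}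
    (h : ∀ x ∈ tsupport ζ, ContDiffAt ℝ n g x) (h0 : ∀ x, ζ x = 0 → g x = 0) :
    ContDiff ℝ n g := by
  refine contDiff_iff_contDiffAt.2 fun x => ?_
  by_cases hx : x ∈ tsupport ζ
  · exact h x hx
  · have : g =ᶠ[𝓝 x] fun _ => 0 := by
      filter_upwards [notMem_tsupport_iff_eventuallyEq.1 hx] with y hy using h0 y hy
    exact contDiffAt_const.congr_of_eventuallyEq this

theorem Potential.contDiff_fn (V : Potential) : ContDiff ℝ 2 V.fn :=
  ((Potential.exists_fn_eq_iff _).1 ⟨V, rfl⟩).1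

/-- For a smooth bump `ζ` supported where `V < E`, and `v = √(2 (E - V))`, the function `v ζ` and
the potential `v³ ζ'` are related by a first order identity which involves only `C¹` functions. -/
theorem exists_potentials_of_bump (V : Potential) {E x₀ : ℝ} (ζ : ContDiffBump x₀)
    (hE : ∀ x ∈ Metric.closedBall x₀ ζ.rOut, V.fn x < E) :
    ∃ Ψ X : Potential, (∀ x, Ψ.fn x = √(2 * (E - V.fn x)) * ζ x) ∧
      ∀ x, X.fn x = 2 * (E - V.fn x) * Ψ.d1 x + V.d1 x * Ψ.fn x := by
  have hts : tsupport ζ = Metric.closedBall x₀ ζ.rOut := ζ.tsupport_eq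
  have hζ : ∀ n : ℕ∞, ContDiff ℝ n ζ := fun n => ζ.contDiff
  have hζ' : ContDiff ℝ 2 (deriv ζ) := by
    have h3 : ContDiff ℝ (2 + 1) ζ := hζ 3
    rw [contDiff_succ_iff_deriv] at h3
    exact h3.2.2
  -- The square root need not be smooth where `V` reaches `E`; only its behaviour over the support
  -- of `ζ` matters.
  have hv : ∀ x ∈ tsupport ζ, ContDiffAt ℝ 2 (fun x => √(2 * (E - V.fn x))) x := fun x hx =>
    (contDiffAt_const.mul (contDiffAt_const.sub V.contDiff_fn.contDiffAt)).sqrt (by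
      have := hE x (hts ▸ hx); linarith)
  have hs : HasCompactSupport ζ := ζ.hasCompactSupport
  obtain ⟨Ψ, hΨ⟩ := Potential.exists_fn_eq_of_hasCompactSupport
    (g := fun x => √(2 * (E - V.fn x)) * ζ x)
    (contDiff_of_forall_mem_tsupport (ζ := ζ) (fun x hx => (hv x hx).mul (hζ 2).contDiffAt)
      fun x hx => by simp [hx]) hs.mul_left
  obtain ⟨X, hX⟩ := Potential.exists_fn_eq_of_hasCompactSupport
    (g := fun x => √(2 * (E - V.fn x)) ^ 3 * deriv ζ x)
    (contDiff_of_forall_mem_tsupport (ζ := deriv ζ)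
      (fun x hx => ((hv x (tsupport_deriv_subset hx)).pow 3).mul hζ'.contDiffAt)
      fun x hx => by simp [hx]) hs.deriv.mul_left
  refine ⟨Ψ, X, hΨ, fun x => ?_⟩
  by_cases hx : x ∈ tsupport ζ
  · have hpos : 0 < 2 * (E - V.fn x) := by have := hE x (hts ▸ hx); linarith
    have hvx : HasDerivAt (fun x => √(2 * (E - V.fn x))) _ x :=
      (((V.hasDerivAt_fn x).const_sub E).const_mul 2).sqrt hpos.ne'
    have hd := (hvx.mul (((hζ 1).differentiable (by norm_num) x).hasDerivAt)
      ).congr_of_eventuallyEq (Eventually.of_forall hΨ)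
    rw [(Ψ.hasDerivAt_fn x).unique hd, hΨ, hX]
    have hsq : √(2 * (E - V.fn x)) ^ 2 = 2 * (E - V.fn x) := Real.sq_sqrt hpos.le
    have hne : √(2 * (E - V.fn x)) ≠ 0 := (Real.sqrt_pos.2 hpos).ne'
    rw [← hsq, Real.sqrt_sq (Real.sqrt_nonneg _)]
    field_simp
    ring
  · have hev := notMem_tsupport_iff_eventuallyEq.1 hx
    have hΨ0 : Ψ.fn =ᶠ[𝓝 x] fun _ => 0 := by
      filter_upwards [hev] with y hy
      rw [hΨ, hy]; simp
    have h1 : Ψ.d1 x = 0 := by rw [← Ψ.deriv_fn, hΨ0.deriv_eq]; simp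
    rw [hX, hΨ0.self_of_nhds, h1, hev.deriv_eq]
    simp

theorem exists_linearised_eq_and_cosCLM_pos {T : ℝ} (hT : 1 ≤ T) {V : Potential} {q : CT2 T}
    (h : newtonMap T q V = 0) (hper : HasResonantPeriods q) :
    ∃ (k : CT2 T) (X : Potential),
      (∀ t, k.d2 t + V.d2 (q.fn t) * k.fn t = X.d1 (q.fn t)) ∧ 0 < CT2.cosCLM T k := by
  -- The time `1` serves because it lies in `[0, T]`, `sin 1 ≠ 0` forces `q̇(1) ≠ 0`, and `cos 1 >
  -- 0`.
  have h1 : q.d1 1 ≠ 0 := fun h0 => (Real.sin_pos_of_pos_of_lt_pi one_pos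
    (by linarith [Real.pi_gt_three])).ne' ((hasResonantPeriods_iff h).1 hper 1 h0)
  have hcos1 : 0 < Real.cos 1 := Real.cos_one_pos
  set x₀ := q.fn 1
  set E := q.d1 1 ^ 2 / 2 + V.fn x₀ with hE
  have hEx : V.fn x₀ < E := by have := sq_pos_of_ne_zero h1; linarith
  have hstrict : HasStrictDerivAt q.fn (q.d1 1) 1 :=
    hasStrictDerivAt_of_hasDerivAt_of_continuousAt (Eventually.of_forall q.hasDerivAt_fn)
      q.d1.continuous.continuousAt
  have hcos : ∀ᶠ x in 𝓝 x₀, ∀ t, q.fn t = x → 0 < Real.cos t := by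
    -- Since `q̇(1) ≠ 0`, positions near `x₀` are those visited near time `1`; every other visit
    -- there has the same cosine.
    rw [← hstrict.map_nhds_eq h1, eventually_map]
    filter_upwards [Real.continuous_cos.continuousAt.eventually_const_lt hcos1] with s hs t hts
    rwa [cos_eq_cos_of_fn_eq h hper hts]
  obtain ⟨ρ, hρ, H⟩ := Metric.eventually_nhds_iff.1
    (hcos.and (V.fn.continuous.continuousAt.eventually_lt_const hEx))
  let ζ : ContDiffBump x₀ := ⟨ρ / 4, ρ / 2, by linarith, by linarith⟩
  have hball : ∀ x ∈ Metric.closedBall x₀ ζ.rOut, dist x x₀ < ρ := fun x hx =>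
    (Metric.mem_closedBall.1 hx).trans_lt (by simp only [ζ]; linarith)
  obtain ⟨Ψ, X, hΨ, hX⟩ := exists_potentials_of_bump V ζ fun x hx => (H (hball x hx)).2
  refine ⟨CT2.comp Ψ q, X, fun t => ?_, ?_⟩
  · have hXd : X.d1 (q.fn t) = 2 * (E - V.fn (q.fn t)) * Ψ.d2 (q.fn t) -
        V.d1 (q.fn t) * Ψ.d1 (q.fn t) + V.d2 (q.fn t) * Ψ.fn (q.fn t) := by
      have hx := X.hasDerivAt_fn (q.fn t)
      rw [show (X.fn : ℝ → ℝ) = _ from funext hX] at hx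
      rw [hx.unique (((((V.hasDerivAt_fn (q.fn t)).const_sub E).const_mul 2).mul
        (Ψ.hasDerivAt_d1 _)).add ((V.hasDerivAt_d1 _).mul (Ψ.hasDerivAt_fn _)))]
      ring
    have hen := energy_eq h t 1
    rw [CT2.comp_d2, CT2.comp_fn, hXd, d2_eq_of_newton h]
    linear_combination 2 * Ψ.d2 (q.fn t) * hen
  · rw [CT2.cosCLM_apply]
    refine intervalIntegral.integral_pos (by linarith)
      (Continuous.continuousOn (by fun_prop)) (fun t _ => ?_) ⟨1, ⟨zero_le_one, hT⟩, ?_⟩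
    · rw [CT2.comp_fn, hΨ]
      by_cases hz : ζ (q.fn t) = 0
      · simp [hz]
      · have hmem : q.fn t ∈ Metric.ball x₀ ζ.rOut := by
          rw [← ζ.support_eq]; exact hz
        have := (H (hball _ (Metric.ball_subset_closedBall hmem))).1 t rfl
        exact mul_nonneg this.le (mul_nonneg (Real.sqrt_nonneg _) ζ.nonneg)
    · rw [CT2.comp_fn, hΨ]
      refine mul_pos hcos1 (mul_pos (Real.sqrt_pos.2 (by linarith)) ?_)
      rw [ζ.one_of_mem_closedBall (Metric.mem_closedBall_self ζ.rIn_pos.le)]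
      exact one_pos

/-! ### The forced oscillator `χ̈ + χ = x` -/

section OffCentral

variable {τ : ℝ}

theorem eq_zero_of_harmonic {d d' : ℝ → ℝ} (hd : ∀ t, HasDerivAt d (d' t) t)
    (hd' : ∀ t, HasDerivAt d' (-d t) t) {t₀ : ℝ} (h0 : d t₀ = 0) (h1 : d' t₀ = 0) (t : ℝ) :
    d t = 0 := by
  have hE : d t ^ 2 + d' t ^ 2 = d t₀ ^ 2 + d' t₀ ^ 2 := by
    refine is_const_of_deriv_eq_zero (f := fun t => d t ^ 2 + d' t ^ 2)
      (fun t => ?_) (fun t => ?_) t t₀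
    all_goals have h := ((hd t).pow 2).add ((hd' t).pow 2)
    · exact h.differentiableAt
    · refine h.deriv.trans ?_
      simp; ring
  rw [h0, h1] at hE
  nlinarith [sq_nonneg (d t), sq_nonneg (d' t)]

/-- The initial value of an off-central solution. -/
theorem IsOffCentral.fn_zero_mul_sin {x χ : CT2 τ} (h : IsOffCentral x χ) :
    χ.fn 0 * Real.sin (τ / 2) = ∫ s in (0 : ℝ)..τ / 2, Real.cos (τ / 2 - s) * x.fn s := by
  -- Green's identity against the harmonic solution `cos(τ/2 - s)`. Both endpoint velocities vanish
  -- by evenness and periodicity, leaving only `χ(0) sin(τ/2)`.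
  have hderiv : ∀ s : ℝ, HasDerivAt
      (fun s => χ.d1 s * Real.cos (τ / 2 - s) - χ.fn s * Real.sin (τ / 2 - s))
      (Real.cos (τ / 2 - s) * x.fn s) s := fun s => by
    have hs : HasDerivAt (fun s => τ / 2 - s) (-1) s := (hasDerivAt_id s).const_sub (τ / 2)
    refine (((χ.hasDerivAt_d1 s).mul hs.cos).sub
      ((χ.hasDerivAt_fn s).mul hs.sin)).congr_deriv ?_
    rw [← h s]
    ring
  rw [intervalIntegral.integral_eq_sub_of_hasDerivAt (fun s _ => hderiv s)
    (Continuous.intervalIntegrable (by fun_prop) _ _)]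
  have h0 : χ.d1 0 = 0 := by have := χ.d1_neg 0; rw [neg_zero] at this; linarith
  rw [χ.d1_half_of_periodic χ.periodic_fn, h0]
  simp

theorem IsOffCentral.unique (hτ : Real.sin (τ / 2) ≠ 0) {x χ₁ χ₂ : CT2 τ}
    (h₁ : IsOffCentral x χ₁) (h₂ : IsOffCentral x χ₂) : χ₁ = χ₂ := by
  have h0 : χ₁.fn 0 = χ₂.fn 0 :=
    mul_right_cancel₀ hτ (h₁.fn_zero_mul_sin.trans h₂.fn_zero_mul_sin.symm)
  refine CT2.ext_fn fun t => sub_eq_zero.1 ?_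
  refine eq_zero_of_harmonic (d := fun t => χ₁.fn t - χ₂.fn t)
    (d' := fun t => χ₁.d1 t - χ₂.d1 t) (t₀ := 0)
    (fun t => (χ₁.hasDerivAt_fn t).sub (χ₂.hasDerivAt_fn t))
    (fun t => ((χ₁.hasDerivAt_d1 t).sub (χ₂.hasDerivAt_d1 t)).congr_deriv ?_)
    (sub_eq_zero.2 h0) ?_ t
  · linarith [h₁ t, h₂ t]
  · have e1 := χ₁.d1_neg 0
    have e2 := χ₂.d1_neg 0
    rw [neg_zero] at e1 e2
    change χ₁.d1 0 - χ₂.d1 0 = 0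
    linarith

theorem exists_ct2_of_hasDerivAt (hτ : τ ≠ 0) {g g' g'' : ℝ → ℝ}
    (hg : ∀ t, HasDerivAt g (g' t) t) (hg' : ∀ t, HasDerivAt g' (g'' t) t)
    (hc : Continuous g'') (hp : Function.Periodic g τ) (he : Function.Even g) :
    ∃ q : CT2 τ, (∀ t, q.fn t = g t) ∧ ∀ t, q.d2 t = g'' t := by
  have hd : deriv g = g' := funext fun t => (hg t).deriv
  have hd' : deriv g' = g'' := funext fun t => (hg' t).deriv
  have hgc : Continuous g := continuous_iff_continuousAt.2 fun t => (hg t).continuousAt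
  have hgc' : Continuous g' := continuous_iff_continuousAt.2 fun t => (hg' t).continuousAt
  have hper : ∀ {k k' : ℝ → ℝ}, (∀ t, HasDerivAt k (k' t) t) → Function.Periodic k τ →
      Function.Periodic k' τ := fun {k k'} hk hkp t => by
    have h := (hk (t + τ)).comp_add_const t τ
    rw [show (fun x => k (x + τ)) = k from funext hkp] at h
    exact h.unique (hk t)
  have hbd : ∀ {k : ℝ → ℝ}, Continuous k → Function.Periodic k τ → ∃ C, ∀ t, |k t| ≤ C :=
    fun {k} hk hkp => by
      obtain ⟨C, hC⟩ := (hkp.isBounded_of_continuous hτ hk).exists_norm_le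
      exact ⟨C, fun t => hC _ ⟨t, rfl⟩⟩
  obtain ⟨A, hA⟩ := hbd hgc hp
  obtain ⟨B, hB⟩ := hbd hgc' (hper hg hp)
  obtain ⟨C, hC⟩ := hbd hc (hper hg' (hper hg hp))
  obtain ⟨V, hV⟩ := (Potential.exists_fn_eq_iff g).2 ⟨by
    rw [show (2 : WithTop ℕ∞) = 1 + 1 by norm_num, contDiff_succ_iff_deriv, hd,
      contDiff_one_iff_deriv, hd']
    exact ⟨fun t => (hg t).differentiableAt, by simp, fun t => (hg' t).differentiableAt, hc⟩,
    max A (max B C), fun t => ⟨(hA t).trans (by simp), by rw [hd]; exact (hB t).trans (by simp),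
      by rw [hd, hd']; exact (hC t).trans (by simp)⟩⟩
  refine ⟨⟨V, by rwa [← hV] at hp, by rwa [← hV] at he⟩, congrFun hV, fun t => ?_⟩
  change V.d2 t = _
  rw [← V.deriv_d1, ← V.deriv_fn, hV, hd, hd']

theorem exists_isOffCentral (hτ0 : τ ≠ 0) (hτ : Real.sin (τ / 2) ≠ 0) (x : CT2 τ) :
    ∃ χ : CT2 τ, IsOffCentral x χ := by
  have hcx : Continuous fun s => Real.cos s * x.fn s := by fun_prop
  have hsx : Continuous fun s => Real.sin s * x.fn s := by fun_prop
  let C : ℝ → ℝ := fun t => ∫ s in (0 : ℝ)..t, Real.cos s * x.fn s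
  let S : ℝ → ℝ := fun t => ∫ s in (0 : ℝ)..t, Real.sin s * x.fn s
  have hC : ∀ t, HasDerivAt C (Real.cos t * x.fn t) t := fun t =>
    (hcx.integral_hasStrictDerivAt 0 t).hasDerivAt
  have hS : ∀ t, HasDerivAt S (Real.sin t * x.fn t) t := fun t =>
    (hsx.integral_hasStrictDerivAt 0 t).hasDerivAt
  have hCneg : ∀ t, C (-t) = -C t := fun t => by
    have := intervalIntegral.integral_comp_neg (a := 0) (b := t) fun s => Real.cos s * x.fn s
    rw [neg_zero, intervalIntegral.integral_symm 0 (-t)] at this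
    simp only [Real.cos_neg, x.even_fn _] at this
    change C t = -C (-t) at this
    linarith
  have hSneg : ∀ t, S (-t) = S t := fun t => by
    have := intervalIntegral.integral_comp_neg (a := 0) (b := t) fun s => Real.sin s * x.fn s
    rw [neg_zero, intervalIntegral.integral_symm 0 (-t)] at this
    simp only [Real.sin_neg, x.even_fn _, neg_mul, intervalIntegral.integral_neg] at this
    change -S t = -S (-t) at this
    linarith
  -- Variation of constants gives an even solution for each `c`; this choice makes its velocity
  -- vanish at `τ/2`. Then `g` and its `τ`-translate share initial data at `-τ/2`, which gives
  -- periodicity.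
  obtain ⟨c, hc⟩ : ∃ c, -c * Real.sin (τ / 2) + Real.cos (τ / 2) * C (τ / 2) +
      Real.sin (τ / 2) * S (τ / 2) = 0 :=
    ⟨(Real.cos (τ / 2) * C (τ / 2) + Real.sin (τ / 2) * S (τ / 2)) / Real.sin (τ / 2), by
      field_simp; ring⟩
  let g : ℝ → ℝ := fun t => c * Real.cos t + Real.sin t * C t - Real.cos t * S t
  let g' : ℝ → ℝ := fun t => -c * Real.sin t + Real.cos t * C t + Real.sin t * S t
  have hg : ∀ t, HasDerivAt g (g' t) t := fun t => by
    refine ((((Real.hasDerivAt_cos t).const_mul c).add ((Real.hasDerivAt_sin t).mul (hC t))).sub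
      ((Real.hasDerivAt_cos t).mul (hS t))).congr_deriv ?_
    simp only [g']; ring
  have hg' : ∀ t, HasDerivAt g' (x.fn t - g t) t := fun t => by
    refine ((((Real.hasDerivAt_sin t).const_mul (-c)).add
      ((Real.hasDerivAt_cos t).mul (hC t))).add
      ((Real.hasDerivAt_sin t).mul (hS t))).congr_deriv ?_
    simp only [g]; linear_combination x.fn t * Real.sin_sq_add_cos_sq t
  have hgc : Continuous g := continuous_iff_continuousAt.2 fun t => (hg t).continuousAt
  have hge : ∀ t, g (-t) = g t := fun t => by
    simp only [g, Real.cos_neg, Real.sin_neg, hCneg, hSneg]; ring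
  have hgo : ∀ t, g' (-t) = -g' t := fun t => by
    simp only [g', Real.cos_neg, Real.sin_neg, hCneg, hSneg]; ring
  have hgp : ∀ t, g (t + τ) = g t := fun t => by
    refine sub_eq_zero.1 (eq_zero_of_harmonic (d := fun t => g (t + τ) - g t)
      (d' := fun t => g' (t + τ) - g' t) (t₀ := -(τ / 2))
      (fun t => ((hg _).comp_add_const t τ).sub (hg t))
      (fun t => (((hg' _).comp_add_const t τ).sub (hg' t)).congr_deriv ?_) ?_ ?_ t)
    · rw [x.periodic_fn]; ring
    · rw [hge]; ring_nf
    · have : g' (τ / 2) = 0 := hc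
      rw [hgo, this, show -(τ / 2) + τ = τ / 2 by ring, this]; ring
  obtain ⟨χ, h1, h2⟩ := exists_ct2_of_hasDerivAt hτ0 hg hg' (by fun_prop) hgp hge
  exact ⟨χ, fun t => by rw [h1, h2]; ring⟩

end OffCentral

/-! ### The sign change across a resonance -/

theorem hasSignChange_of_integral_ne_zero {T : ℝ} {n : ℕ} (hn : 0 < n)
    (hT : T = 2 * Real.pi * n) {W : Potential} {q : CT2 T}
    (hq : ∫ t in (0 : ℝ)..T, Real.cos t * q.fn t ≠ 0) {δ : ℝ} {x : (τ : ℝ) → CT2 τ}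
    (hx : IsPeriodFamily T W q δ x) : HasSignChange T x := by
  have hTpos : 0 < T := by rw [hT]; positivity
  have hsinT : Real.sin (T / 2) = 0 := by
    rw [hT, show 2 * Real.pi * n / 2 = n * Real.pi by ring, Real.sin_nat_mul_pi]
  let I : ℝ → ℝ := fun τ => ∫ s in (0 : ℝ)..τ / 2, Real.cos (τ / 2 - s) * (x τ).fn s
  -- the integral is nonzero at `T`
  have hIT : I T ≠ 0 := by
    have h1 : I T = Real.cos (T / 2) * ∫ s in (0 : ℝ)..T / 2, Real.cos s * q.fn s := by
      rw [← intervalIntegral.integral_const_mul]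
      refine intervalIntegral.integral_congr fun s _ => ?_
      simp only [hx.base, Real.cos_sub, hsinT]
      ring
    have hcx : Continuous fun s => Real.cos s * q.fn s := by fun_prop
    have hrefl : ∀ s, Real.cos (T - s) * q.fn (T - s) = Real.cos s * q.fn s := fun s => by
      rw [show T - s = -s + T by ring, q.periodic_fn, q.even_fn,
        show -s + T = -s + n * (2 * Real.pi) by rw [hT]; ring,
        Real.cos_add_nat_mul_two_pi, Real.cos_neg]
    -- Reflection in `T / 2` preserves the integrand, so the half-period integral is half the full
    -- one.
    have h2 : ∫ s in T / 2..T, Real.cos s * q.fn s =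
        ∫ s in (0 : ℝ)..T / 2, Real.cos s * q.fn s := by
      have := intervalIntegral.integral_comp_sub_left (a := 0) (b := T / 2)
        (fun s => Real.cos s * q.fn s) T
      rw [sub_zero, sub_half] at this
      rw [← this]
      exact intervalIntegral.integral_congr fun s _ => hrefl s
    have h3 := intervalIntegral.integral_add_adjacent_intervals
      (hcx.intervalIntegrable (μ := MeasureTheory.volume) 0 (T / 2))
      (hcx.intervalIntegrable (T / 2) T)
    rw [h2] at h3
    intro h0
    rw [h1] at h0
    rcases mul_eq_zero.1 h0 with hc | hi
    · have := Real.sin_sq_add_cos_sq (T / 2)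
      rw [hc, hsinT] at this
      norm_num at this
    · rw [hi] at h3
      exact hq (by linarith)
  -- it depends continuously on the period
  have hIcont : ContinuousAt I T := by
    have hδ := hx.pos
    -- Clamping the period makes the integrand continuous on the whole plane without changing it
    -- near `T`.
    let c : ℝ → ℝ := fun τ => max (T - δ / 2) (min τ (T + δ / 2))
    have hc : Continuous c := by fun_prop
    have hcmem : ∀ τ, |c τ - T| < δ := fun τ => by
      rw [abs_lt]
      have h1 : T - δ / 2 ≤ c τ := le_max_left _ _
      have h2 : c τ ≤ T + δ / 2 := max_le (by linarith) (min_le_right _ _)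
      constructor <;> linarith
    have hx' : Continuous fun p : ℝ × ℝ => (x (c p.1)).fn p.2 :=
      hx.continuousOn.comp_continuous (f := fun p : ℝ × ℝ => (c p.1, p.2)) (by fun_prop)
        fun p => hcmem p.1
    have hcont : Continuous fun τ : ℝ =>
        ∫ s in (0 : ℝ)..τ / 2, Real.cos (τ / 2 - s) * (x (c τ)).fn s := by
      refine intervalIntegral.continuous_parametric_intervalIntegral_of_continuous ?_
        (by fun_prop)
      exact (Real.continuous_cos.comp (by fun_prop)).mul hx'
    refine hcont.continuousAt.congr ?_
    filter_upwards [Ioo_mem_nhds (show T - δ / 2 < T by linarith)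
      (show T < T + δ / 2 by linarith)] with τ hτ
    have : c τ = τ := by
      simp only [c]
      rw [min_eq_left hτ.2.le, max_eq_right hτ.1.le]
    simp only [I]
    rw [this]
  have hev : ∀ᶠ τ in 𝓝 T, 0 < I τ * I T :=
    (hIcont.mul continuousAt_const).eventually_const_lt (mul_self_pos.2 hIT)
  obtain ⟨η, hη, H⟩ := Metric.eventually_nhds_iff.1 hev
  have hpi := Real.pi_gt_three
  -- The bound `1` keeps `(τ - T) / 2` within `(-π, π)`, where sine vanishes only at `0`; the bound
  -- `T` keeps `τ` positive.
  refine ⟨min η (min 1 T), lt_min hη (lt_min one_pos hTpos), ?_, ?_⟩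
  all_goals
    have hsin : ∀ τ, Real.sin (τ / 2) = Real.cos (T / 2) * Real.sin ((τ - T) / 2) := fun τ => by
      rw [show τ / 2 = T / 2 + (τ - T) / 2 by ring, Real.sin_add, hsinT]; ring
    have hcosT : Real.cos (T / 2) ^ 2 = 1 := by
      have := Real.sin_sq_add_cos_sq (T / 2)
      rw [hsinT] at this
      linarith
    have hcos0 : Real.cos (T / 2) ≠ 0 := fun h => by rw [h] at hcosT; norm_num at hcosT
  · intro τ hne hτ
    obtain ⟨-, hτ1, hτT⟩ : |τ - T| < η ∧ |τ - T| < 1 ∧ |τ - T| < T := by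
      simpa [lt_min_iff] using hτ
    rw [abs_lt] at hτ1 hτT
    have hτs : Real.sin (τ / 2) ≠ 0 := by
      rw [hsin]
      refine mul_ne_zero hcos0 ?_
      rw [Ne, Real.sin_eq_zero_iff_of_lt_of_lt (by linarith) (by linarith)]
      intro h
      exact hne (by linarith)
    obtain ⟨χ, hχ⟩ := exists_isOffCentral (by linarith) hτs (x τ)
    exact ⟨χ, hχ, fun χ' hχ' => hχ'.unique hτs hχ⟩
  · intro τ₁ h₁ τ₂ h₂ χ₁ χ₂ hχ₁ hχ₂
    have hm1 : min η (min 1 T) ≤ η := min_le_left _ _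
    have hm2 : min η (min 1 T) ≤ 1 := (min_le_right _ _).trans (min_le_left _ _)
    have hI1 : 0 < I τ₁ * I T := H (by
      rw [Real.dist_eq, abs_lt]; constructor <;> linarith [h₁.1, h₁.2])
    have hI2 : 0 < I τ₂ * I T := H (by
      rw [Real.dist_eq, abs_lt]; constructor <;> linarith [h₂.1, h₂.2])
    have hs1 : Real.sin ((τ₁ - T) / 2) < 0 :=
      Real.sin_neg_of_neg_of_neg_pi_lt (by linarith [h₁.2]) (by linarith [h₁.1])
    have hs2 : 0 < Real.sin ((τ₂ - T) / 2) :=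
      Real.sin_pos_of_pos_of_lt_pi (by linarith [h₂.1]) (by linarith [h₂.2])
    have e1 : χ₁.fn 0 * Real.sin (τ₁ / 2) = I τ₁ := hχ₁.fn_zero_mul_sin
    have e2 : χ₂.fn 0 * Real.sin (τ₂ / 2) = I τ₂ := hχ₂.fn_zero_mul_sin
    rw [hsin] at e1 e2
    have hI : 0 < I τ₁ * I τ₂ := by
      have : 0 < (I τ₁ * I τ₂) * (I T * I T) := by nlinarith
      exact pos_of_mul_pos_left this (mul_self_nonneg _)
    -- The unknown sign `cos(T/2) = ±1` enters both factors and squares away.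
    have hprod : (χ₁.fn 0 * χ₂.fn 0) * (Real.sin ((τ₁ - T) / 2) * Real.sin ((τ₂ - T) / 2)) =
        I τ₁ * I τ₂ := by
      rw [← e1, ← e2]
      linear_combination -(χ₁.fn 0 * χ₂.fn 0) *
        (Real.sin ((τ₁ - T) / 2) * Real.sin ((τ₂ - T) / 2)) * hcosT
    rw [← hprod] at hI
    exact neg_of_mul_pos_left hI (mul_neg_of_neg_of_pos hs1 hs2).le

theorem IsPerturbationNhd.fderiv_cosCLM_comp_ne_zero {T : ℝ} (hT : 1 ≤ T) {V₀ : Potential}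
    {q₀ : CT2 T} {U : Set Potential} {f : Potential → CT2 T}
    (hUf : IsPerturbationNhd T q₀ V₀ U f) {W : Potential} (hW : W ∈ U)
    (hper : HasResonantPeriods (f W)) : fderiv ℝ (fun X => CT2.cosCLM T (f X)) W ≠ 0 := by
  obtain ⟨k, X, hk, hpos⟩ :=
    exists_linearised_eq_and_cosCLM_pos hT (hUf.anharmonic W hW).newton hper
  have hf : DifferentiableAt ℝ f W := (hUf.contDiffOn.contDiffAt
    (hUf.isOpen.mem_nhds hW)).differentiableAt one_ne_zero
  intro h0
  have h1 := ((CT2.cosCLM T).hasFDerivAt.comp W hf.hasFDerivAt).fderiv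
  have h2 : CT2.cosCLM T (fderiv ℝ f W X) = 0 := by
    rw [← ContinuousLinearMap.comp_apply, ← h1]
    exact congrArg (fun A : Potential →L[ℝ] ℝ => A X) h0
  rw [hUf.fderiv_eq_neg hW hk, map_neg] at h2
  linarith

end

theorem theorem2 (T : ℝ) (n : ℕ) (hn : 0 < n) (hT : T = 2 * Real.pi * n)
    (V₀ : Potential) (q₀ : CT2 T) (hdeg : IsDegenerate T V₀ q₀)
    (hper : ∀ p : ℝ, Function.Periodic q₀.fn p → ∃ m : ℤ, p = 2 * Real.pi * m)
    (U : Set Potential) (f : Potential → CT2 T) (hUf : IsPerturbationNhd T q₀ V₀ U f)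
    (hU : IsConnected U) :
    IsC1SubmanifoldOfCodim 1 {W ∈ U | IsDegenerate T W (f W)} ∧
      (IsOpen {W ∈ U | ¬ IsDegenerate T W (f W)} ∧
        U ⊆ closure {W ∈ U | ¬ IsDegenerate T W (f W)} ∧
        ∀ W ∈ U, ¬ IsDegenerate T W (f W) →
          ∀ (δ : ℝ) (x : (τ : ℝ) → CT2 τ), IsPeriodFamily T W (f W) δ x →
            HasSignChange T x) := by
  have hT1 : 1 ≤ T := by
    have h1 : (1 : ℝ) ≤ n := by exact_mod_cast hn
    rw [hT]
    nlinarith [Real.pi_gt_three]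
  let g : Potential → ℝ := fun W => CT2.cosCLM T (f W)
  have hdegen : ∀ W ∈ U, (IsDegenerate T W (f W) ↔ g W = 0) := fun W hW =>
    ⟨fun h => h.integral_eq_zero, fun h => ⟨hUf.anharmonic W hW, h⟩⟩
  have hS : {W ∈ U | IsDegenerate T W (f W)} = {W ∈ U | g W = 0} :=
    Set.ext fun W => and_congr_right (hdegen W)
  have hS' : {W ∈ U | ¬ IsDegenerate T W (f W)} = {W ∈ U | g W ≠ 0} :=
    Set.ext fun W => and_congr_right fun hW => not_congr (hdegen W hW)
  have hg : ContDiffOn ℝ 1 g U := (CT2.cosCLM T).contDiff.comp_contDiffOn hUf.contDiffOn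
  have hreg : ∀ W ∈ U, g W = 0 → fderiv ℝ g W ≠ 0 := fun W hW _ =>
    hUf.fderiv_cosCLM_comp_ne_zero hT1 hW
      (hUf.hasResonantPeriods hn hT hper hU.isPreconnected hW)
  rw [hS, hS']
  refine ⟨isC1SubmanifoldOfCodim_zeroSet hUf.isOpen hg hreg, ?_,
    subset_closure_ne_zero hUf.isOpen hreg, fun W hW hnd δ x hx => ?_⟩
  · exact hg.continuousOn.isOpen_inter_preimage hUf.isOpen isOpen_ne
  · exact hasSignChange_of_integral_ne_zero hn hT (fun h => hnd ((hdegen W hW).2 h)) hx
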